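/- Let $q\in(1,2)$ and $p=\frac{q}{q-1}$. There exists a constant $\tilde C_q>0$, depending only on $q$, such that for every $n\in\mathbb{N}$ and every probability measure $\mu$ on $\mathbb{R}^n$ having a density $g:\mathbb{R}^n\to[0,\infty)$ with respect to Lebesgue measure $\lambda_n$ that is differentiable at every point of $\mathbb{R}^n$, $$\mathsf{H}(\mu\|\lambda_n)\;\le\;\sum_{i=1}^n\ \inf_{t_i>0}\Big\{\tilde C_q\,t_i^{\,q}\int_{\mathbb{R}^n}\Big|\frac{\partial_i g(x)}{g(x)}\Big|^q\,d\mu(x)+\frac{\tilde C_q}{t_i^{\,p}}\int_{\mathbb{R}^n}|x_i|^p\,d\mu(x)-\log t_i\Big\}.$$ Here $\mathsf{H}(\mu\|\lambda_n)=\int_{\mathbb{R}^n}\log\big(\tfrac{d\mu}{d\lambda_n}\big)\,d\mu\in[-\infty,+\infty]$ is the relative entropy, taken to be $+\infty$ if the positive part of the integrand is not $\mu$-integrable. The integrals on the right-hand side take values in $[0,+\infty]$ (the quotient $\partial_i g/g$ is defined $\mu$-almost everywhere, since $\mu(\{g=0\})=0$), and the inequality is understood in $[-\infty,+\infty]$.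 -/

import Mathlib

open MeasureTheory
open scoped ENNReal

/-- The relative entropy `H(μ‖ν) = ∫ log (dμ/dν) dμ`, with values in `[-∞, +∞]`. For an infinite
reference measure such as Lebesgue measure it may be negative, or `-∞`. It is `+∞` when `μ` has no
density with respect to `ν` or when the positive part of `log (dμ/dν)` has infinite integral
(in particular when the positive and the negative part both do). -/
noncomputable def relEntropy {α : Type*} [MeasurableSpace α] (μ ν : Measure α) : EReal :=
  open Classical in
  if μ ≪ ν ∧ ∫⁻ x, ENNReal.ofReal (llr μ ν x) ∂μ ≠ ∞ then
    ((∫⁻ x, ENNReal.ofReal (llr μ ν x) ∂μ : ℝ≥0∞) : EReal)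
      - ((∫⁻ x, ENNReal.ofReal (-llr μ ν x) ∂μ : ℝ≥0∞) : EReal)
  else ⊤

/-- The partial derivative `∂ᵢ g (x)` of a function on `ℝⁿ`. -/
noncomputable def partialD {n : ℕ} (i : Fin n) (g : (Fin n → ℝ) → ℝ) (x : Fin n → ℝ) : ℝ :=
  fderiv ℝ g x (Pi.single i 1)

/-- The integral `∫ |∂ᵢ g / g| ^ q dμ ∈ [0, +∞]`. -/
noncomputable def fisherQ {n : ℕ} (q : ℝ) (i : Fin n) (g : (Fin n → ℝ) → ℝ)
    (μ : Measure (Fin n → ℝ)) : ℝ≥0∞ :=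
  ∫⁻ x, ENNReal.ofReal (|partialD i g x / g x| ^ q) ∂μ

/-- The absolute moment `∫ |xᵢ| ^ p dμ ∈ [0, +∞]`. -/
noncomputable def absMoment {n : ℕ} (p : ℝ) (i : Fin n) (μ : Measure (Fin n → ℝ)) : ℝ≥0∞ :=
  ∫⁻ x, ENNReal.ofReal (|x i| ^ p) ∂μ

/-! The moment terms are not needed, and `C = 1` suffices. Let A_i be the Lebesgue L¹ norm of ∂ᵢg.
On almost every line parallel to an axis, g is integrable, hence bounded by the integral of |∂ᵢg|
along that line. Feeding these n bounds into a Loomis–Whitney type inequality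
(`lmarginal_mul_prod_lmarginal_pow_le`) gives ∫ g^(1+r) ≤ ∏ A_i^r for small r > 0. The left side is
the μ-integral of exp(r log g), so Jensen yields H ≤ ∑ log A_i (`relEntropy_le_sum_log`). Since ∂ᵢg
= (∂ᵢg/g) g, monotonicity of L^q(μ) norms gives A_i ≤ I_i^(1/q), with I_i the q-Fisher information,
and log(tA_i) ≤ (tA_i)^q gives log A_i ≤ t^q I_i - log t. -/

/-! ### Loomis–Whitney type inequalities -/

/-- Grid-lines inequality with a separate function for every direction: a Hölder-type form of the
Loomis–Whitney inequality for partial integrals. -/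
theorem lmarginal_mul_prod_lmarginal_pow_le {ι : Type*} [DecidableEq ι] {X : ι → Type*}
    [∀ i, MeasurableSpace (X i)] (μ : ∀ i, Measure (X i)) [∀ i, SigmaFinite (μ i)]
    {p : ℝ} (hp : 0 < p) {f : ι → (∀ i, X i) → ℝ≥0∞} (hf : ∀ i, Measurable (f i))
    (s : Finset ι) (hs : ((s.card : ℝ) - 1) * p ≤ 1) {g : (∀ i, X i) → ℝ≥0∞} (hg : Measurable g)
    (x : ∀ i, X i) :
    (∫⋯∫⁻_s, fun y ↦ g y ^ (1 - ((s.card : ℝ) - 1) * p) *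
        ∏ i ∈ s, (∫⋯∫⁻_{i}, f i ∂μ) y ^ p ∂μ) x ≤
      (∫⋯∫⁻_s, g ∂μ) x ^ (1 - ((s.card : ℝ) - 1) * p) *
        ∏ i ∈ s, (∫⋯∫⁻_s, f i ∂μ) x ^ p := by
  induction s using Finset.induction generalizing f g x with
  | empty => simp
  | insert i s hi ih =>
    rw [Finset.card_insert_of_notMem hi] at hs ⊢
    push_cast at hs ⊢
    rw [add_sub_cancel_right] at hs ⊢
    set k : ℝ := (s.card : ℝ)
    set e : ℝ := 1 - (k - 1) * p with he_def
    have he : 0 < e := by simp only [he_def]; nlinarith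
    have hk : 0 ≤ 1 - k * p := by linarith
    have hsum : p / e + (1 - k * p) / e = 1 := by
      rw [← add_div, div_eq_one_iff_eq he.ne']; simp only [he_def]; ring
    have hm : ∀ j, Measurable (∫⋯∫⁻_{i}, f j ∂μ) := fun j ↦ (hf j).lmarginal μ
    have hgm : Measurable (∫⋯∫⁻_{i}, g ∂μ) := hg.lmarginal μ
    set F := ∫⋯∫⁻_{i}, f i ∂μ
    set G := ∫⋯∫⁻_{i}, g ∂μ
    -- Chosen so that w^e = F^p G^(1-kp): w replaces g in the induction hypothesis. Since e = p + (1
    -- - kp), its two exponents sum to 1, as the final Hölder step requires.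
    let w : (∀ i, X i) → ℝ≥0∞ := fun y ↦ F y ^ (p / e) * G y ^ ((1 - k * p) / e)
    have hw : Measurable w := ((hm i).pow_const _).mul (hgm.pow_const _)
    have hsing : ∀ (h : (∀ i, X i) → ℝ≥0∞) y,
        ∫⁻ t, h (Function.update y i t) ∂(μ i) = (∫⋯∫⁻_{i}, h ∂μ) y := fun h y ↦ by
      rw [lmarginal_singleton]
    have hins : ∀ h : (∀ i, X i) → ℝ≥0∞, Measurable h →
        ∫⋯∫⁻_insert i s, h ∂μ = ∫⋯∫⁻_s, ∫⋯∫⁻_{i}, h ∂μ ∂μ := fun h hh ↦ by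
      rw [lmarginal_insert' _ hh hi]
      simp only [← lmarginal_singleton]
    calc _ = (∫⋯∫⁻_s, (fun y ↦ ∫⁻ t, g (Function.update y i t) ^ (1 - k * p) *
              ∏ j ∈ insert i s, (∫⋯∫⁻_{j}, f j ∂μ) (Function.update y i t) ^ p ∂(μ i)) ∂μ) x := by
          rw [lmarginal_insert' _ _ hi]
          exact (hg.pow_const _).mul <| Finset.measurable_fun_prod _ fun j _ ↦
            ((hf j).lmarginal μ).pow_const _
      _ ≤ (∫⋯∫⁻_s, (fun y ↦ w y ^ e * ∏ j ∈ s, (∫⋯∫⁻_{j}, ∫⋯∫⁻_{i}, f j ∂μ ∂μ) y ^ p) ∂μ) x := by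
          refine lmarginal_mono (fun y ↦ ?_) x
          have hF : ∀ t, F (Function.update y i t) = F y := fun t ↦
            lmarginal_update_of_mem μ (Finset.mem_singleton_self i) _ _ _
          have hu : Measurable (Function.update y i) := measurable_update y
          have hmj : ∀ j, Measurable fun t ↦ (∫⋯∫⁻_{j}, f j ∂μ) (Function.update y i t) :=
            fun j ↦ ((hf j).lmarginal μ).comp hu
          have hw' : w y ^ e = F y ^ p * G y ^ (1 - k * p) := by
            simp only [w]
            rw [ENNReal.mul_rpow_of_nonneg _ _ he.le, ← ENNReal.rpow_mul, ← ENNReal.rpow_mul,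
              div_mul_cancel₀ _ he.ne', div_mul_cancel₀ _ he.ne']
          -- F is constant along direction i and factors out; Hölder then applies with weights 1 -
          -- kp and k copies of p.
          calc _ = ∫⁻ t, F y ^ p * (g (Function.update y i t) ^ (1 - k * p) *
                  ∏ j ∈ s, (∫⋯∫⁻_{j}, f j ∂μ) (Function.update y i t) ^ p) ∂(μ i) := by
                refine lintegral_congr fun t ↦ ?_
                rw [Finset.prod_insert hi, show (∫⋯∫⁻_{i}, f i ∂μ) _ = F y from hF t]
                ring
            _ = F y ^ p * ∫⁻ t, g (Function.update y i t) ^ (1 - k * p) *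
                  ∏ j ∈ s, (∫⋯∫⁻_{j}, f j ∂μ) (Function.update y i t) ^ p ∂(μ i) :=
                lintegral_const_mul _ <| ((hg.comp hu).pow_const _).mul <|
                  Finset.measurable_fun_prod _ fun j _ ↦ (hmj j).pow_const _
            _ ≤ F y ^ p * ((∫⁻ t, g (Function.update y i t) ∂(μ i)) ^ (1 - k * p) *
                  ∏ j ∈ s, (∫⁻ t, (∫⋯∫⁻_{j}, f j ∂μ) (Function.update y i t) ∂(μ i)) ^ p) := by
                gcongr
                refine ENNReal.lintegral_mul_prod_norm_pow_le s (hg.comp hu).aemeasurable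
                  (fun j _ ↦ (hmj j).aemeasurable) _ ?_ hk fun _ _ ↦ hp.le
                simp only [Finset.sum_const, nsmul_eq_mul]
                ring
            _ = _ := by
                rw [hw', mul_assoc]
                congr 2
                · rw [hsing]
                · refine Finset.prod_congr rfl fun j hj ↦ ?_
                  have hij : i ≠ j := fun h ↦ hi (h ▸ hj)
                  rw [hsing, ← lmarginal_union μ _ (hf j) (by simpa using hij),
                    ← lmarginal_union μ _ (hf j) (by simpa using hij.symm), Finset.union_comm]
      _ ≤ (∫⋯∫⁻_s, w ∂μ) x ^ e * ∏ j ∈ s, (∫⋯∫⁻_s, ∫⋯∫⁻_{i}, f j ∂μ ∂μ) x ^ p :=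
          ih hm (by linarith) hw x
      _ ≤ ((∫⋯∫⁻_s, F ∂μ) x ^ (p / e) * (∫⋯∫⁻_s, G ∂μ) x ^ ((1 - k * p) / e)) ^ e *
            ∏ j ∈ s, (∫⋯∫⁻_s, ∫⋯∫⁻_{i}, f j ∂μ ∂μ) x ^ p := by
          gcongr
          exact ENNReal.lintegral_mul_norm_pow_le
            ((hm i).comp measurable_updateFinset).aemeasurable
            (hgm.comp measurable_updateFinset).aemeasurable (by positivity) (by positivity) hsum
      _ = _ := by
          rw [ENNReal.mul_rpow_of_nonneg _ _ he.le, ← ENNReal.rpow_mul, ← ENNReal.rpow_mul,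
            div_mul_cancel₀ _ he.ne', div_mul_cancel₀ _ he.ne', Finset.prod_insert hi,
            hins g hg, hins (f i) (hf i), ← Finset.prod_congr rfl fun j _ ↦ congrArg (fun u ↦ u x ^ p) (hins (f j) (hf j))]
          ring

theorem lintegral_mul_prod_lmarginal_pow_le {ι : Type*} [Fintype ι] [DecidableEq ι] {X : ι → Type*}
    [∀ i, MeasurableSpace (X i)] (μ : ∀ i, Measure (X i)) [∀ i, SigmaFinite (μ i)]
    {p : ℝ} (hp : 0 < p) (hp' : ((Fintype.card ι : ℝ) - 1) * p ≤ 1)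
    {f : ι → (∀ i, X i) → ℝ≥0∞} (hf : ∀ i, Measurable (f i))
    {g : (∀ i, X i) → ℝ≥0∞} (hg : Measurable g) :
    ∫⁻ y, g y ^ (1 - ((Fintype.card ι : ℝ) - 1) * p) *
        ∏ i, (∫⋯∫⁻_{i}, f i ∂μ) y ^ p ∂.pi μ ≤
      (∫⁻ y, g y ∂.pi μ) ^ (1 - ((Fintype.card ι : ℝ) - 1) * p) *
        ∏ i, (∫⁻ y, f i y ∂.pi μ) ^ p := by
  cases isEmpty_or_nonempty (∀ i, X i) with
  | inl h => simp [Measure.eq_zero_of_isEmpty]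
  | inr h =>
    inhabit ∀ i, X i
    simpa [lmarginal_univ] using
      lmarginal_mul_prod_lmarginal_pow_le μ hp hf Finset.univ (by simpa using hp') hg default

/-- Almost every line parallel to a coordinate axis carries a finite integral. -/
theorem ae_lmarginal_singleton_lt_top {ι : Type*} [Fintype ι] [DecidableEq ι] {X : ι → Type*}
    [∀ i, MeasurableSpace (X i)] (μ : ∀ i, Measure (X i)) [∀ i, SigmaFinite (μ i)]
    {f : (∀ i, X i) → ℝ≥0∞} (hf : Measurable f) (hfin : ∫⁻ x, f x ∂.pi μ ≠ ∞) (i : ι) :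
    ∀ᵐ x ∂Measure.pi μ, (∫⋯∫⁻_{i}, f ∂μ) x < ∞ := by
  cases isEmpty_or_nonempty (∀ i, X i) with
  | inl h => exact Filter.Eventually.of_forall h.elim
  | inr h =>
  inhabit ∀ i, X i
  have hF : Measurable (∫⋯∫⁻_{i}, f ∂μ) := hf.lmarginal μ
  have hN : MeasurableSet {x | (∫⋯∫⁻_{i}, f ∂μ) x = ∞} := hF (measurableSet_singleton ∞)
  set N := {x | (∫⋯∫⁻_{i}, f ∂μ) x = ∞}
  have hone : Measurable (N.indicator (1 : (∀ i, X i) → ℝ≥0∞)) := measurable_one.indicator hN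
  have hdisj : Disjoint {i} (Finset.univ.erase i) := by simp
  have hun : {i} ∪ Finset.univ.erase i = (Finset.univ : Finset ι) := by ext; simp
  -- By Tonelli the line integrals have finite total integral over the other coordinates, so almost
  -- all of them are finite.
  have hzero : ∀ x, (∫⋯∫⁻_Finset.univ.erase i, N.indicator 1 ∂μ) x = 0 := fun x ↦ by
    have h1 : (∫⋯∫⁻_Finset.univ.erase i, ∫⋯∫⁻_{i}, f ∂μ ∂μ) x = ∫⁻ x, f x ∂.pi μ := by
      rw [← lmarginal_union μ f hf hdisj.symm, Finset.union_comm, hun, lmarginal_univ]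
    have h2 : ∀ᵐ y ∂Measure.pi fun j : (Finset.univ.erase i : Finset ι) ↦ μ j,
        (∫⋯∫⁻_{i}, f ∂μ) (Function.updateFinset x _ y) < ∞ :=
      ae_lt_top (hF.comp measurable_updateFinset) (by rw [← h1] at hfin; exact hfin)
    refine (lintegral_congr_ae (g := 0) ?_).trans (by simp)
    filter_upwards [h2] with y hy
    exact Set.indicator_of_notMem (s := N) (fun h ↦ hy.ne h) _
  have hNull : Measure.pi μ N = 0 := by
    rw [← lintegral_indicator_one hN, lintegral_eq_lmarginal_univ default, ← hun,
      lmarginal_union μ _ hone hdisj, funext hzero]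
    exact lintegral_zero
  filter_upwards [measure_eq_zero_iff_ae_notMem.mp hNull] with x hx
  exact lt_top_iff_ne_top.mpr hx

/-! ### Bounding a density by its partial derivatives -/

/-- A nonnegative differentiable integrable function on the line is bounded by the total variation
`∫ |h'|`. -/
theorem ofReal_le_lintegral_enorm_deriv {h : ℝ → ℝ} (hd : Differentiable ℝ h)
    (hfin : ∫⁻ y, ENNReal.ofReal (h y) ≠ ∞) (x : ℝ) :
    ENNReal.ofReal (h x) ≤ ∫⁻ y, ‖deriv h y‖ₑ := by
  by_cases htop : ∫⁻ y, ‖deriv h y‖ₑ = ∞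
  · simp [htop]
  have hint : Integrable (deriv h) :=
    ⟨(measurable_deriv h).aestronglyMeasurable, lt_top_iff_ne_top.mpr htop⟩
  refine ENNReal.le_of_forall_pos_le_add fun ε hε _ ↦ ?_
  -- Otherwise h exceeds ε on a half-line and its integral is infinite.
  obtain ⟨a, hax, ha⟩ : ∃ a < x, ENNReal.ofReal (h a) ≤ ε := by
    by_contra! hcon
    refine hfin (top_unique ?_)
    calc (∞ : ℝ≥0∞) = ∫⁻ _ in Set.Iio x, (ε : ℝ≥0∞) := by
          simp [hε.ne', Real.volume_Iio]
      _ ≤ ∫⁻ y in Set.Iio x, ENNReal.ofReal (h y) :=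
          setLIntegral_mono' measurableSet_Iio fun y hy ↦ (hcon y hy).le
      _ ≤ _ := setLIntegral_le_lintegral _ _
  have hftc : ∫ y in a..x, deriv h y = h x - h a :=
    intervalIntegral.integral_eq_sub_of_hasDerivAt (fun y _ ↦ (hd y).hasDerivAt)
      hint.intervalIntegrable
  calc ENNReal.ofReal (h x) = ENNReal.ofReal ((h x - h a) + h a) := by simp
    _ ≤ ENNReal.ofReal (h x - h a) + ENNReal.ofReal (h a) := ENNReal.ofReal_add_le
    _ ≤ (∫⁻ y, ‖deriv h y‖ₑ) + ε := by
        gcongr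
        rw [← hftc, intervalIntegral.integral_of_le hax.le]
        calc _ ≤ ‖∫ y in Set.Ioc a x, deriv h y‖ₑ := Real.ofReal_le_enorm _
          _ ≤ ∫⁻ y in Set.Ioc a x, ‖deriv h y‖ₑ := enorm_integral_le_lintegral_enorm _
          _ ≤ _ := setLIntegral_le_lintegral _ _

theorem hasDerivAt_update_partialD {n : ℕ} {g : (Fin n → ℝ) → ℝ} (hg : Differentiable ℝ g)
    (i : Fin n) (x : Fin n → ℝ) (y : ℝ) :
    HasDerivAt (fun t ↦ g (Function.update x i t)) (partialD i g (Function.update x i y)) y :=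
  (hg _).hasFDerivAt.comp_hasDerivAt y (hasDerivAt_update x i y)

theorem measurable_partialD {n : ℕ} (i : Fin n) (g : (Fin n → ℝ) → ℝ) :
    Measurable (partialD i g) :=
  measurable_fderiv_apply_const ℝ g _

/-- The Lebesgue `L¹` norm of `∂ᵢ g` is controlled by the `q`-Fisher information of the density. -/
theorem lintegral_enorm_partialD_le {n : ℕ} {q : ℝ} (hq : 1 ≤ q) {g : (Fin n → ℝ) → ℝ}
    (hg0 : ∀ x, 0 ≤ g x) (hg : Differentiable ℝ g) {μ : Measure (Fin n → ℝ)}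
    [IsProbabilityMeasure μ]
    (hμ : μ = (volume : Measure (Fin n → ℝ)).withDensity (fun x => ENNReal.ofReal (g x)))
    (i : Fin n) :
    (∫⁻ x, ‖partialD i g x‖ₑ) ≤ fisherQ q i g μ ^ (1 / q) := by
  have hq0 : 0 < q := by linarith
  have hgm : Measurable fun x ↦ ENNReal.ofReal (g x) := hg.continuous.measurable.ennreal_ofReal
  have hr : Measurable fun x ↦ ‖partialD i g x / g x‖ₑ :=
    ((measurable_partialD i g).div hg.continuous.measurable).enorm
  have hpt : ∀ x, ‖partialD i g x‖ₑ = ENNReal.ofReal (g x) * ‖partialD i g x / g x‖ₑ := fun x ↦ by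
    rcases (hg0 x).eq_or_lt with h | h
    -- A zero of g ≥ 0 is a minimum, so ∂ᵢg vanishes there too.
    · have : IsLocalMin g x := Filter.Eventually.of_forall fun y ↦ h ▸ hg0 y
      simp [partialD, this.fderiv_eq_zero, ← h]
    · rw [← Real.enorm_of_nonneg h.le, ← enorm_mul, mul_div_cancel₀ _ h.ne']
  have h1 : (∫⁻ x, ‖partialD i g x‖ₑ) = ∫⁻ x, ‖partialD i g x / g x‖ₑ ∂μ := by
    rw [hμ, lintegral_withDensity_eq_lintegral_mul _ hgm hr]
    exact lintegral_congr hpt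
  have h2 : fisherQ q i g μ = ∫⁻ x, ‖partialD i g x / g x‖ₑ ^ q ∂μ :=
    lintegral_congr fun x ↦ by
      rw [← ENNReal.ofReal_rpow_of_nonneg (abs_nonneg _) hq0.le, Real.enorm_eq_ofReal_abs]
  rw [h1, h2]
  have := eLpNorm'_le_eLpNorm'_of_exponent_le (μ := μ) one_pos hq
    ((measurable_partialD i g).div hg.continuous.measurable).aestronglyMeasurable
  simpa [eLpNorm'] using this

theorem ae_ofReal_le_lmarginal_enorm_partialD {n : ℕ} {g : (Fin n → ℝ) → ℝ}
    (hg : Differentiable ℝ g) (hfin : ∫⁻ x, ENNReal.ofReal (g x) ≠ ∞) (i : Fin n) :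
    ∀ᵐ x, ENNReal.ofReal (g x) ≤
      (∫⋯∫⁻_{i}, fun y ↦ ‖partialD i g y‖ₑ ∂(fun _ ↦ (volume : Measure ℝ))) x := by
  have hgm : Measurable fun x ↦ ENNReal.ofReal (g x) := hg.continuous.measurable.ennreal_ofReal
  filter_upwards [ae_lmarginal_singleton_lt_top (fun _ : Fin n ↦ (volume : Measure ℝ)) hgm
    hfin i] with x hx
  rw [lmarginal_singleton] at hx ⊢
  have hd : ∀ t, HasDerivAt (fun t ↦ g (Function.update x i t))
      (partialD i g (Function.update x i t)) t := hasDerivAt_update_partialD hg i x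
  have := ofReal_le_lintegral_enorm_deriv (fun t ↦ (hd t).differentiableAt) hx.ne (x i)
  simpa [(hd _).deriv] using this

/-- A Gagliardo–Nirenberg type bound for a probability density. -/
theorem lintegral_rpow_le_prod_lintegral_enorm_partialD {n : ℕ} {g : (Fin n → ℝ) → ℝ}
    (hg : Differentiable ℝ g) (hone : ∫⁻ x, ENNReal.ofReal (g x) = 1) {p : ℝ} (hp : 0 < p)
    (hp' : ((n : ℝ) - 1) * p ≤ 1) :
    ∫⁻ x, ENNReal.ofReal (g x) ^ (1 + p) ≤ ∏ i, (∫⁻ x, ‖partialD i g x‖ₑ) ^ p := by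
  have hgm : Measurable fun x ↦ ENNReal.ofReal (g x) := hg.continuous.measurable.ennreal_ofReal
  have hgrid := lintegral_mul_prod_lmarginal_pow_le (fun _ : Fin n ↦ (volume : Measure ℝ)) hp
    (by simpa using hp') (f := fun i y ↦ ‖partialD i g y‖ₑ)
    (fun i ↦ (measurable_partialD i g).enorm) hgm
  simp only [← volume_pi, hone, ENNReal.one_rpow, one_mul, Fintype.card_fin] at hgrid
  refine le_trans (lintegral_mono_ae ?_) hgrid
  filter_upwards [ae_all_iff.mpr fun i ↦
    ae_ofReal_le_lmarginal_enorm_partialD hg (by simp [hone]) i] with x hx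
  calc ENNReal.ofReal (g x) ^ (1 + p)
      = ENNReal.ofReal (g x) ^ (1 - ((n : ℝ) - 1) * p) *
          ∏ _i : Fin n, ENNReal.ofReal (g x) ^ p := by
        rw [Finset.prod_const, Finset.card_univ, Fintype.card_fin, ← ENNReal.rpow_natCast,
          ← ENNReal.rpow_mul, ← ENNReal.rpow_add_of_nonneg _ _ (by linarith) (by positivity)]
        congr 1
        ring
    _ ≤ _ := by
        gcongr with i
        exact hx i

/-- A vanishing factor in the Gagliardo–Nirenberg bound would force g = 0 almost everywhere.
Positivity makes the logarithms of the norms meaningful. -/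
theorem lintegral_enorm_partialD_ne_zero {n : ℕ} {g : (Fin n → ℝ) → ℝ}
    (hg : Differentiable ℝ g) (hone : ∫⁻ x, ENNReal.ofReal (g x) = 1) (i : Fin n) :
    (∫⁻ x, ‖partialD i g x‖ₑ) ≠ 0 := fun h ↦ by
  have hm : Measurable fun x ↦ ‖partialD i g x‖ₑ := (measurable_partialD i g).enorm
  -- Any p > 0 with (n - 1)p ≤ 1 would do; this choice also covers n = 0 and n = 1.
  set p : ℝ := 1 / (n + 1) with hp_def
  have hp : 0 < p := by positivity
  have hp' : ((n : ℝ) - 1) * p ≤ 1 := by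
    rw [hp_def, mul_one_div, div_le_one (by positivity)]; linarith
  have hle := lintegral_rpow_le_prod_lintegral_enorm_partialD hg hone hp hp'
  rw [Finset.prod_eq_zero (Finset.mem_univ i) (by rw [h, ENNReal.zero_rpow_of_pos hp]),
    nonpos_iff_eq_zero, lintegral_eq_zero_iff
      (hg.continuous.measurable.ennreal_ofReal.pow_const _)] at hle
  have h0 : ∫⁻ x, ENNReal.ofReal (g x) = 0 := by
    refine (lintegral_congr_ae (g := 0) ?_).trans (by simp)
    filter_upwards [hle] with x hx
    exact (ENNReal.rpow_eq_zero_iff_of_pos (by positivity)).mp hx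
  simp [hone] at h0

/-! ### Entropy through an exponential moment -/

/-- The positive and negative parts of `L` are compared through an exponential moment. -/
theorem lintegral_posPart_sub_negPart_le {α : Type*} [MeasurableSpace α] {μ : Measure α}
    [IsProbabilityMeasure μ] {L : α → ℝ} (hL : Measurable L) {p a : ℝ} (hp : 0 < p)
    (hexp : ∫⁻ x, ENNReal.ofReal (Real.exp (p * L x)) ∂μ ≤ ENNReal.ofReal (Real.exp (p * a))) :
    ∫⁻ x, ENNReal.ofReal (L x) ∂μ ≠ ∞ ∧
      ((∫⁻ x, ENNReal.ofReal (L x) ∂μ : ℝ≥0∞) : EReal)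
        - ((∫⁻ x, ENNReal.ofReal (-L x) ∂μ : ℝ≥0∞) : EReal) ≤ (a : EReal) := by
  have hem : Measurable fun x ↦ Real.exp (p * L x) := by fun_prop
  have hint : Integrable (fun x ↦ Real.exp (p * L x)) μ :=
    (lintegral_ofReal_ne_top_iff_integrable hem.aestronglyMeasurable
      (Filter.Eventually.of_forall fun _ ↦ (Real.exp_pos _).le)).mp
      (hexp.trans_lt ENNReal.ofReal_lt_top).ne
  have hfin : ∫⁻ x, ENNReal.ofReal (L x) ∂μ ≠ ∞ := by
    have hi : Integrable (fun x ↦ Real.exp (p * L x) / p) μ := hint.div_const p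
    refine ne_top_of_le_ne_top ((lintegral_ofReal_ne_top_iff_integrable hi.aestronglyMeasurable
      (Filter.Eventually.of_forall fun _ ↦ by positivity)).mpr hi) (lintegral_mono fun x ↦ ?_)
    refine ENNReal.ofReal_le_ofReal ?_
    rw [le_div_iff₀ hp]
    linarith [Real.add_one_le_exp (p * L x)]
  refine ⟨hfin, ?_⟩
  by_cases hneg : ∫⁻ x, ENNReal.ofReal (-L x) ∂μ = ∞
  · simp [hneg]
  have hLi : Integrable L μ := by
    refine ⟨hL.aestronglyMeasurable, ?_⟩
    calc ∫⁻ x, ‖L x‖ₑ ∂μ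
        ≤ ∫⁻ x, (ENNReal.ofReal (L x) + ENNReal.ofReal (-L x)) ∂μ := by
          refine lintegral_mono fun x ↦ ?_
          rw [Real.enorm_eq_ofReal_abs]
          rcases abs_cases (L x) with h | h <;> simp [h.1]
      _ = _ := lintegral_add_left hL.ennreal_ofReal _
      _ < ∞ := ENNReal.add_lt_top.mpr ⟨lt_top_iff_ne_top.mpr hfin, lt_top_iff_ne_top.mpr hneg⟩
  have heq := integral_eq_lintegral_pos_part_sub_lintegral_neg_part hLi
  have hle : ∫ x, Real.exp (p * L x) ∂μ ≤ Real.exp (p * a) := by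
    rw [← ENNReal.ofReal_le_ofReal_iff (Real.exp_pos _).le, ofReal_integral_eq_lintegral_ofReal
      hint (Filter.Eventually.of_forall fun _ ↦ (Real.exp_pos _).le)]
    exact hexp
  have hmain : ∫ x, L x ∂μ ≤ a := by
    -- Jensen by hand: the tangent line of exp at pa.
    have hpt : ∀ x, L x ≤ (Real.exp (p * L x) / Real.exp (p * a) - 1) / p + a := fun x ↦ by
      rw [← Real.exp_sub, ← sub_le_iff_le_add, le_div_iff₀ hp]
      linarith [Real.add_one_le_exp (p * L x - p * a)]
    have hi1 : Integrable (fun x ↦ Real.exp (p * L x) / Real.exp (p * a) - 1) μ :=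
      (hint.div_const (Real.exp (p * a))).sub (integrable_const (1 : ℝ))
    calc ∫ x, L x ∂μ ≤ ∫ x, ((Real.exp (p * L x) / Real.exp (p * a) - 1) / p + a) ∂μ :=
          integral_mono hLi ((hi1.div_const p).add (integrable_const a)) hpt
      _ = ((∫ x, Real.exp (p * L x) ∂μ) / Real.exp (p * a) - 1) / p + a := by
          rw [integral_add (hi1.div_const p) (integrable_const a), integral_div,
            integral_sub (hint.div_const _) (integrable_const _), integral_div]
          simp
      _ ≤ a := by
          have : (∫ x, Real.exp (p * L x) ∂μ) / Real.exp (p * a) ≤ 1 :=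
            (div_le_one (Real.exp_pos _)).mpr hle
          have := div_nonpos_of_nonpos_of_nonneg (sub_nonpos.mpr this) hp.le
          linarith
  rw [heq] at hmain
  rw [← EReal.coe_ennreal_toReal hfin, ← EReal.coe_ennreal_toReal hneg, ← EReal.coe_sub]
  exact_mod_cast hmain

/-- The relative entropy with respect to Lebesgue measure is bounded by the logarithms of the
`L¹` norms of the partial derivatives. -/
theorem relEntropy_le_sum_log {n : ℕ} {g : (Fin n → ℝ) → ℝ} (hg0 : ∀ x, 0 ≤ g x)
    (hg : Differentiable ℝ g) {μ : Measure (Fin n → ℝ)} [IsProbabilityMeasure μ]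
    (hμ : μ = (volume : Measure (Fin n → ℝ)).withDensity (fun x => ENNReal.ofReal (g x)))
    (hA : ∀ i, (∫⁻ x, ‖partialD i g x‖ₑ) ≠ ∞) :
    relEntropy μ volume ≤
      ∑ i, ((Real.log (∫⁻ x, ‖partialD i g x‖ₑ).toReal : ℝ) : EReal) := by
  have hgm : Measurable fun x ↦ ENNReal.ofReal (g x) := hg.continuous.measurable.ennreal_ofReal
  have hone : ∫⁻ x, ENNReal.ofReal (g x) = 1 := by
    have : μ Set.univ = 1 := measure_univ
    rwa [hμ, withDensity_apply _ MeasurableSet.univ, Measure.restrict_univ] at this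
  have hac : μ ≪ volume := hμ ▸ withDensity_absolutelyContinuous _ _
  set A : Fin n → ℝ := fun i ↦ (∫⁻ x, ‖partialD i g x‖ₑ).toReal
  have hApos : ∀ i, 0 < A i := fun i ↦
    ENNReal.toReal_pos (lintegral_enorm_partialD_ne_zero hg hone i) (hA i)
  set p : ℝ := 1 / (n + 1) with hp_def
  have hp : 0 < p := by positivity
  have hp' : ((n : ℝ) - 1) * p ≤ 1 := by
    rw [hp_def, mul_one_div, div_le_one (by positivity)]; linarith
  have hexp_llr : ∀ᵐ x ∂μ, ENNReal.ofReal (Real.exp (p * llr μ volume x)) =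
      ENNReal.ofReal (g x) ^ p := by
    have hrn : ∀ᵐ x ∂μ, μ.rnDeriv volume x = ENNReal.ofReal (g x) := by
      have := Measure.rnDeriv_withDensity volume hgm
      rw [← hμ] at this
      exact hac.ae_le this
    filter_upwards [exp_llr_of_ac μ volume hac, hrn] with x hx hx'
    rw [mul_comm, Real.exp_mul, hx, hx', ENNReal.toReal_ofReal (hg0 x),
      ENNReal.ofReal_rpow_of_nonneg (hg0 x) hp.le]
  have hexp : ∫⁻ x, ENNReal.ofReal (Real.exp (p * llr μ volume x)) ∂μ ≤
      ENNReal.ofReal (Real.exp (p * ∑ i, Real.log (A i))) := by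
    calc _ = ∫⁻ x, ENNReal.ofReal (g x) ^ p ∂μ := lintegral_congr_ae hexp_llr
      _ = ∫⁻ x, ENNReal.ofReal (g x) ^ (1 + p) := by
          conv_lhs => rw [hμ, lintegral_withDensity_eq_lintegral_mul _ hgm (hgm.pow_const _)]
          refine lintegral_congr fun x ↦ ?_
          rw [ENNReal.rpow_add_of_nonneg _ _ zero_le_one hp.le, ENNReal.rpow_one, Pi.mul_apply]
      _ ≤ ∏ i, (∫⁻ x, ‖partialD i g x‖ₑ) ^ p :=
          lintegral_rpow_le_prod_lintegral_enorm_partialD hg hone hp hp'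
      _ = _ := by
          rw [Finset.mul_sum, Real.exp_sum, ENNReal.ofReal_prod_of_nonneg fun _ _ ↦
            (Real.exp_pos _).le]
          refine Finset.prod_congr rfl fun i _ ↦ ?_
          rw [mul_comm, Real.exp_mul, Real.exp_log (hApos i),
            ← ENNReal.ofReal_rpow_of_pos (hApos i), ENNReal.ofReal_toReal (hA i)]
  obtain ⟨h1, h2⟩ := lintegral_posPart_sub_negPart_le (measurable_llr μ volume) hp hexp
  rw [relEntropy, if_pos ⟨hac, h1⟩]
  refine h2.trans_eq ?_
  induction (Finset.univ : Finset (Fin n)) using Finset.induction with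
  | empty => simp
  | insert i s hi ih => rw [Finset.sum_insert hi, Finset.sum_insert hi, EReal.coe_add, ih]

/-! ### Optimisation in t and conclusion -/

/-- Optimising `t ^ q * I - log t` over `t > 0` recovers at least `log (I ^ (1 / q))`. -/
theorem log_le_mul_rpow_sub_log {q t A I : ℝ} (hq : 1 ≤ q) (ht : 0 < t) (hA : 0 < A)
    (hI : 0 ≤ I) (hAI : A ≤ I ^ (1 / q)) : Real.log A ≤ t ^ q * I - Real.log t := by
  have hq0 : 0 < q := by linarith
  have hAq : A ^ q ≤ I := by
    calc A ^ q ≤ (I ^ (1 / q)) ^ q := Real.rpow_le_rpow hA.le hAI hq0.le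
      _ = I := by rw [← Real.rpow_mul hI, one_div_mul_cancel hq0.ne', Real.rpow_one]
  have h1 : (t * A) ^ q ≤ t ^ q * I := by
    rw [Real.mul_rpow ht.le hA.le]
    gcongr
  have h2 : Real.log (t * A) ≤ (t * A) ^ q := by
    have hpos : 0 < t * A := by positivity
    calc Real.log (t * A) ≤ max (Real.log (t * A)) 0 := le_max_left _ _
      _ ≤ (t * A) ^ q := by
        refine max_le ?_ (by positivity)
        -- This gives q log y ≤ y^q - 1 for y = tA; q ≥ 1 removes the factor q when log y > 0.
        have h3 := Real.log_le_sub_one_of_pos (Real.rpow_pos_of_pos hpos q)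
        rw [Real.log_rpow hpos] at h3
        rcases le_or_gt (Real.log (t * A)) 0 with h4 | h4
        · exact h4.trans (by positivity)
        · nlinarith
  rw [Real.log_mul ht.ne' hA.ne'] at h2
  linarith

theorem EReal.sum_ne_bot {ι : Type*} {s : Finset ι} {f : ι → EReal} (h : ∀ i ∈ s, f i ≠ ⊥) :
    ∑ i ∈ s, f i ≠ ⊥ :=
  Finset.sum_induction f (· ≠ ⊥) (fun _ _ ha hb ↦ EReal.add_ne_bot_iff.mpr ⟨ha, hb⟩) (by simp) h

theorem mainTheorem12 (q p : ℝ) (hq : q ∈ Set.Ioo (1 : ℝ) 2) (hp : p = q / (q - 1)) :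
    ∃ C : ℝ, 0 < C ∧
      ∀ (n : ℕ) (μ : Measure (Fin n → ℝ)) [IsProbabilityMeasure μ] (g : (Fin n → ℝ) → ℝ),
        (∀ x, 0 ≤ g x) → Differentiable ℝ g →
        μ = (volume : Measure (Fin n → ℝ)).withDensity (fun x => ENNReal.ofReal (g x)) →
        relEntropy μ (volume : Measure (Fin n → ℝ)) ≤
          ∑ i : Fin n, ⨅ t : Set.Ioi (0 : ℝ),
            (((ENNReal.ofReal (C * (t : ℝ) ^ q) * fisherQ q i g μ : ℝ≥0∞) : EReal)
              + ((ENNReal.ofReal (C / (t : ℝ) ^ p) * absMoment p i μ : ℝ≥0∞) : EReal)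
              - ((Real.log (t : ℝ) : ℝ) : EReal)) := by
  refine ⟨1, one_pos, fun n μ _ g hg0 hg hμ ↦ ?_⟩
  have hq1 : 1 ≤ q := hq.1.le
  have hq0 : 0 < q := by linarith
  have hone : ∫⁻ x, ENNReal.ofReal (g x) = 1 := by
    have : μ Set.univ = 1 := measure_univ
    rwa [hμ, withDensity_apply _ MeasurableSet.univ, Measure.restrict_univ] at this
  have hHolder := lintegral_enorm_partialD_le hq1 hg0 hg hμ
  have hAtop : ∀ i, fisherQ q i g μ ≠ ∞ → (∫⁻ x, ‖partialD i g x‖ₑ) ≠ ∞ := fun i hi ↦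
    ne_top_of_le_ne_top (ENNReal.rpow_ne_top_of_nonneg (by positivity) hi) (hHolder i)
  have hterm : ∀ i, fisherQ q i g μ ≠ ∞ →
      ((Real.log (∫⁻ x, ‖partialD i g x‖ₑ).toReal : ℝ) : EReal) ≤
        ⨅ t : Set.Ioi (0 : ℝ),
          (((ENNReal.ofReal (1 * (t : ℝ) ^ q) * fisherQ q i g μ : ℝ≥0∞) : EReal)
            + ((ENNReal.ofReal (1 / (t : ℝ) ^ p) * absMoment p i μ : ℝ≥0∞) : EReal)
            - ((Real.log (t : ℝ) : ℝ) : EReal)) := fun i hi ↦ by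
    refine le_iInf fun ⟨t, ht⟩ ↦ ?_
    have ht : 0 < t := ht
    have hreal := log_le_mul_rpow_sub_log hq1 ht
      (ENNReal.toReal_pos (lintegral_enorm_partialD_ne_zero hg hone i) (hAtop i hi))
      (ENNReal.toReal_nonneg (a := fisherQ q i g μ)) (by
        rw [ENNReal.toReal_rpow]
        exact ENNReal.toReal_mono (ENNReal.rpow_ne_top_of_nonneg (by positivity) hi) (hHolder i))
    have hcoe : ((ENNReal.ofReal (1 * t ^ q) * fisherQ q i g μ : ℝ≥0∞) : EReal) =
        ((t ^ q * (fisherQ q i g μ).toReal : ℝ) : EReal) := by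
      rw [← EReal.coe_ennreal_toReal (ENNReal.mul_ne_top ENNReal.ofReal_ne_top hi),
        ENNReal.toReal_mul, one_mul, ENNReal.toReal_ofReal (by positivity)]
    calc _ ≤ ((t ^ q * (fisherQ q i g μ).toReal - Real.log t : ℝ) : EReal) := by
          exact_mod_cast hreal
      _ = ((t ^ q * (fisherQ q i g μ).toReal : ℝ) : EReal) - (Real.log t : EReal) :=
          EReal.coe_sub _ _
      _ ≤ _ := by
          rw [hcoe]
          exact EReal.sub_le_sub (le_add_of_nonneg_right (EReal.coe_ennreal_nonneg _)) le_rfl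
  by_cases hfin : ∀ i, fisherQ q i g μ ≠ ∞
  · exact (relEntropy_le_sum_log hg0 hg hμ fun i ↦ hAtop i (hfin i)).trans
      (Finset.sum_le_sum fun i _ ↦ hterm i (hfin i))
  -- One infinite Fisher term should make the sum ⊤, but ⊤ + ⊥ = ⊥ in `EReal`, so the other terms
  -- must be shown to differ from ⊥.
  · push Not at hfin
    obtain ⟨j, hj⟩ := hfin
    have htop : ∀ i, fisherQ q i g μ = ∞ → (⨅ t : Set.Ioi (0 : ℝ),
          (((ENNReal.ofReal (1 * (t : ℝ) ^ q) * fisherQ q i g μ : ℝ≥0∞) : EReal)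
            + ((ENNReal.ofReal (1 / (t : ℝ) ^ p) * absMoment p i μ : ℝ≥0∞) : EReal)
            - ((Real.log (t : ℝ) : ℝ) : EReal))) = ⊤ := fun i hi ↦ by
      refine iInf_eq_top.mpr fun ⟨t, ht⟩ ↦ ?_
      have ht : 0 < t := ht
      have hne : ENNReal.ofReal (1 * t ^ q) ≠ 0 := by
        simpa using Real.rpow_pos_of_pos ht q
      rw [hi, ENNReal.mul_top hne, EReal.coe_ennreal_top, EReal.top_add_of_ne_bot
        (EReal.coe_ennreal_ne_bot _), EReal.top_sub_coe]
    rw [← Finset.add_sum_erase _ _ (Finset.mem_univ j), htop j hj, EReal.top_add_of_ne_bot]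
    · exact le_top
    · refine EReal.sum_ne_bot fun i _ ↦ ?_
      by_cases hi : fisherQ q i g μ = ∞
      · rw [htop i hi]; exact top_ne_bot
      · exact ne_bot_of_le_ne_bot (EReal.coe_ne_bot _) (hterm i hi)
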